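/- Let $G=(V,E)$ be a finite simple graph, and let $(e_v)_{v\in V}$ be the canonical basis of $\mathbb{R}^V$. The graphical zonotope $Z_G\subset\mathbb{R}^V$ is the Minkowski sum of the segments $[e_u,e_v]$ over all edges $\{u,v\}\in E$ (so $Z_G=\{0\}$ if $E=\varnothing$). A polytope is the convex hull of finitely many points. The deformation cone $\mathrm{DC}(Z_G)$ is the set of all polytopes $Q\subset\mathbb{R}^V$ that are weak Minkowski summands of $Z_G$, that is, for which there are a real $\lambda\ge 0$ and a polytope $R$ with $Q+R=\lambda Z_G$. For $h\in\mathbb{R}^{2^V}$ let $$P_h=\Bigl\{x\in\mathbb{R}^V : \sum_{v\in S}x_v-\sum_{v\notin S}x_v\le h_S\ \text{ for all } S\subseteq V\Bigr\}.$$ Let $L_G\subseteq\mathbb{R}^{2^V}$ be the linear space defined by the equations 1. $h_\varnothing=-h_V$, and 2. $h_{S\setminus\{u\}}+h_{S\setminus\{v\}}=h_S+h_{S\setminus\{u,v\}}$ for every $S\subseteq V$ and all distinct $u,v\in S$ with $\{u,v\}\notin E$, and let $C_G$ be the polyhedral cone of all $h\in L_G$ that satisfy the inequalities 3. $h_{S\cup\{u\}}+h_{S\cup\{v\}}\ge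 h_S+h_{S\cup\{u,v\}}$ for every edge $\{u,v\}\in E$ and every $S\subseteq N(u)\cap N(v)$, where $N(u)$ denotes the set of neighbours of $u$. **Theorem.** For every finite simple graph $G=(V,E)$: (a) $\mathrm{DC}(Z_G)=\{P_h : h\in C_G\}$. Moreover $h\mapsto P_h$ is a linear identification of $C_G$ with $\mathrm{DC}(Z_G)$: it is injective on $C_G$, and $P_{h+h'}=P_h+P_{h'}$ and $P_{\lambda h}=\lambda P_h$ for all $h,h'\in C_G$ and all $\lambda\ge 0$. (b) The linear span of $C_G$ is $L_G$. If for each $S\subseteq V$ that does not induce a clique of $G$ one keeps in (2) only the equation of one arbitrarily chosen pair of distinct non-adjacent vertices $u,v\in S$, then these equations together with (1) are linearly independent and still define $L_G$. (c) The inequalities (3) are an irredundant facet description of $C_G$. Call a face of $C_G$ the set of zeros on $C_G$ of a linear function that is non-negative on $C_G$, and a facet a face whose linear span has codimension $1$ in the linear span of $C_G$. Then each inequality in (3) defines a facet (the set of $h\in C_G$ at which it is an equality); inequalities for different pairs $(\{u,v\},S)$ define different facets; every facet is defined by one of them; and none of them is implied by the equations together with the other inequalities. -/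

import Mathlib

open scoped Pointwise

namespace GraphicalZonotope

/-! ### Polytopes, deformations, faces of cones -/

section Polyhedral

variable {E : Type*} [AddCommGroup E] [Module ℝ E]

/-- A polytope is the convex hull of finitely many points. -/
def IsPolytope (P : Set E) : Prop :=
  ∃ s : Finset E, P = convexHull ℝ (s : Set E)

/-- `Q` is a weak Minkowski summand of `P`: for some scalar `r ≥ 0` and some polytope `R`,
the Minkowski sum `Q + R` is the dilate `r • P`. -/
def IsWeakMinkowskiSummand (Q P : Set E) : Prop :=
  ∃ r : ℝ, 0 ≤ r ∧ ∃ R : Set E, IsPolytope R ∧ Q + R = r • P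

/-- The deformation cone of `P`: all polytopes that are weak Minkowski summands of `P`. -/
def deformationCone (P : Set E) : Set (Set E) :=
  {Q | IsPolytope Q ∧ IsWeakMinkowskiSummand Q P}

/-- The faces of a polyhedral cone `C` are the zero sets on `C` of the linear functions that are
non-negative on `C`. -/
def IsConeFace (C F : Set E) : Prop :=
  ∃ l : Module.Dual ℝ E, (∀ x ∈ C, 0 ≤ l x) ∧ F = {x ∈ C | l x = 0}

/-- A facet of a polyhedral cone is a face of codimension `1`; the dimension of a cone is the
dimension of its linear span. -/
def IsConeFacet (C F : Set E) : Prop :=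
  IsConeFace C F ∧
    Module.finrank ℝ (Submodule.span ℝ F) + 1 = Module.finrank ℝ (Submodule.span ℝ C)

end Polyhedral

/-! ### Graphical zonotopes and deformed permutahedra -/

section Graph

variable {V : Type*} [Fintype V] [DecidableEq V]

/-- The segment `[e_u, e_v]` in `ℝ^V` attached to the unordered pair `{u, v}`. -/
def pairSegment : Sym2 V → Set (V → ℝ) :=
  Sym2.lift ⟨fun u v => segment ℝ (Pi.single u (1 : ℝ)) (Pi.single v (1 : ℝ)),
    fun _ _ => segment_symm ℝ _ _⟩

/-- The graphical zonotope: the Minkowski sum of the segments `[e_u, e_v]` over all edges. -/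
def graphicalZonotope (G : SimpleGraph V) [DecidableRel G.Adj] : Set (V → ℝ) :=
  ∑ e ∈ G.edgeFinset, pairSegment e

/-- The deformed permutahedron `P_h` of a height vector `h ∈ ℝ^(2^V)`. -/
def deformedPermutahedron (h : Finset V → ℝ) : Set (V → ℝ) :=
  {x | ∀ S : Finset V, ∑ v ∈ S, x v - ∑ v ∈ Sᶜ, x v ≤ h S}

/-- The height vectors satisfying `h_∅ = -h_V` and the modularity equations of all non-edges. -/
def equationSpace (G : SimpleGraph V) : Set (Finset V → ℝ) :=
  {h | h ∅ = -h Finset.univ ∧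
    ∀ (S : Finset V) (u v : V), u ∈ S → v ∈ S → u ≠ v → ¬ G.Adj u v →
      h (S \ {u}) + h (S \ {v}) = h S + h (S \ {u, v})}

/-- The triples `(u, v, S)` indexing the inequalities: `{u, v}` is an edge and `S` is contained in
the common neighbourhood of `u` and `v`. -/
def IsIneqIndex (G : SimpleGraph V) (u v : V) (S : Finset V) : Prop :=
  G.Adj u v ∧ (S : Set V) ⊆ G.neighborSet u ∩ G.neighborSet v

/-- The cone of height vectors cut out by the equations of `equationSpace` and the submodularity
inequalities of all edges and all subsets of their common neighbourhoods. -/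
def heightCone (G : SimpleGraph V) : Set (Finset V → ℝ) :=
  {h | h ∈ equationSpace G ∧
    ∀ (u v : V) (S : Finset V), IsIneqIndex G u v S →
      h S + h (S ∪ {u, v}) ≤ h (S ∪ {u}) + h (S ∪ {v})}

/-- The part of the height cone where the inequality indexed by `(u, v, S)` is an equality. -/
def tightPart (G : SimpleGraph V) (u v : V) (S : Finset V) : Set (Finset V → ℝ) :=
  {h | h ∈ heightCone G ∧ h S + h (S ∪ {u, v}) = h (S ∪ {u}) + h (S ∪ {v})}

/-- `c` selects a non-edge `{(c S).1, (c S).2} ⊆ S` for each `S` not inducing a clique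
(in particular `S` has at least two elements); its other values are irrelevant. -/
def IsNonEdgeChoice (G : SimpleGraph V) (c : Finset V → V × V) : Prop :=
  ∀ S : Finset V, ¬ G.IsClique (S : Set V) →
    (c S).1 ∈ S ∧ (c S).2 ∈ S ∧ (c S).1 ≠ (c S).2 ∧ ¬ G.Adj (c S).1 (c S).2

/-- The coordinate form `h ↦ h_S` on `ℝ^(2^V)`. -/
def coordForm (S : Finset V) : Module.Dual ℝ (Finset V → ℝ) :=
  LinearMap.proj S

/-- The linear forms of the equations that a choice of non-edges selects: `none` gives
`h ↦ h_∅ + h_V`, and `some S`, for `S` not inducing a clique, gives the modularity form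
`h ↦ h_S + h_{S ∖ {u, v}} - h_{S ∖ u} - h_{S ∖ v}` of the selected non-edge `{u, v}` of `S`. -/
def chosenForm (G : SimpleGraph V) (c : Finset V → V × V) :
    Option {S : Finset V // ¬ G.IsClique (S : Set V)} → Module.Dual ℝ (Finset V → ℝ)
  | none => coordForm ∅ + coordForm Finset.univ
  | some S => coordForm S.1 + coordForm (S.1 \ {(c S.1).1, (c S.1).2})
      - coordForm (S.1 \ {(c S.1).1}) - coordForm (S.1 \ {(c S.1).2})

end Graph

end GraphicalZonotope

open GraphicalZonotope

/-!
Everything is expressed through the second differences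
`D_{uv,X} h = h_{X ∪ u} + h_{X ∪ v} - h_X - h_{X ∪ {u, v}}` for distinct `u, v ∉ X`. The equations
say that `D_{uv,X} h = 0` at every non-edge. Third differences are symmetric in their three
directions, so for such `h` and an edge `{u, v}` the value `D_{uv,X} h` depends only on the part of
`X` in the common neighbourhood of `u` and `v` (`secondDiff_union_eq`). Hence the height cone
consists of the submodular functions that satisfy the equations (`mem_heightCone_iff`).

For a submodular `h` with `h_∅ = -h_V`, the greedy algorithm attaches to each linear order of `V` a
point of `P_h`, linear in `h`, and `P_h` is the convex hull of these points
(`deformedPermutahedron_eq_convexHull`). This gives additivity and homogeneity of `h ↦ P_h`, and,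
since the inequalities of nested sets are simultaneously tight at some greedy point
(`exists_tight`), injectivity.

The zonotope is `P_z` for a `z` with `D_{uv,X} z = 2` at every edge. So `t z - h` lies in the height
cone for every `h` in the cone and large `t`, which makes `P_h` a weak summand. Conversely, let
`Q + R = t Z_G`, and let `h_S` and `g_S` be the maxima over `Q` and `R` of the linear form of `S`.
Points of `t Z_G` at which several inequalities are tight decompose into maximizers on `Q` and `R`,
so `h` and `g` lie in the height cone (`mem_heightCone_of_add_eq`). As `Q ⊆ P_h`, `R ⊆ P_g` and
`Q + R = P_h + P_g`, cancellation gives `Q = P_h` (`eq_of_add_eq`).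

For the facets, two facts about the inequalities suffice: `z` satisfies all of them strictly, and
for each of them there is a vector at which it is tight and all others are strict
(`exists_only_tight`). For the inequality of `(u, v, S)` such a vector is one whose second
difference `D_{uv,X}` is twice the size of the symmetric difference of `X` and `S`. It is built from
the edge `{u, v}` and the triangles containing it, and then corrected by a large multiple of the
other edges. Linear algebra does the rest (`isConeFacet_tight`, `exists_eq_tight_of_isConeFacet`,
`exists_violating`).

That one equation for each non-clique suffices (`isModularOffEdges_of_choice`) follows from the
symmetry of third and fourth differences by induction on the size of the set. The chosen equations
are independent (`linearIndependent_chosenForm`) because they are triangular with respect to size,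
once the form `h_∅ + h_V` is separated from the others by a constant function.
-/

namespace GraphicalZonotope

/-! ### Facets of a cone given by linear inequalities on a subspace -/

section Cone

variable {E ι : Type*} [AddCommGroup E] [Module ℝ E]

/-- The cone cut out in a subspace `L` by the inequalities `0 ≤ φ i x`. -/
def ineqCone (L : Submodule ℝ E) (φ : ι → Module.Dual ℝ E) : Set E :=
  {x | x ∈ L ∧ ∀ i, 0 ≤ φ i x}

variable {L : Submodule ℝ E} {φ : ι → Module.Dual ℝ E}

/-- Adding a large multiple of `z` to `y` makes all the forms that are positive at `z`
non-negative. -/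
theorem exists_nonneg_add_smul [Finite ι] (φ : ι → Module.Dual ℝ E) (y z : E) :
    ∃ t : ℝ, 0 ≤ t ∧ ∀ i, 0 < φ i z → 0 ≤ φ i (y + t • z) := by
  obtain ⟨b, hb⟩ := (Set.finite_range fun i => -φ i y / φ i z).bddAbove
  refine ⟨max b 0, le_max_right _ _, fun i hi => ?_⟩
  have h1 : -φ i y / φ i z ≤ max b 0 := (hb ⟨i, rfl⟩).trans (le_max_left _ _)
  rw [div_le_iff₀ hi] at h1
  simp only [map_add, map_smul, smul_eq_mul]
  linarith

theorem span_ineqCone [Finite ι] {z : E} (hz : z ∈ L) (hpos : ∀ i, 0 < φ i z) :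
    Submodule.span ℝ (ineqCone L φ) = L := by
  refine le_antisymm (Submodule.span_le.2 fun x hx => hx.1) fun y hy => ?_
  obtain ⟨t, -, ht⟩ := exists_nonneg_add_smul φ y z
  have h1 : y + t • z ∈ ineqCone L φ :=
    ⟨L.add_mem hy (L.smul_mem _ hz), fun i => ht i (hpos i)⟩
  have h2 : z ∈ ineqCone L φ := ⟨hz, fun i => (hpos i).le⟩
  have h3 := Submodule.sub_mem _ (Submodule.subset_span h1)
    (Submodule.smul_mem _ t (Submodule.subset_span h2))
  simpa using h3

theorem span_tight [Finite ι] {i : ι} {p : E} (hp : p ∈ L) (h0 : φ i p = 0)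
    (hpos : ∀ j, φ j ≠ φ i → 0 < φ j p) :
    Submodule.span ℝ {x ∈ ineqCone L φ | φ i x = 0} = L ⊓ LinearMap.ker (φ i) := by
  refine le_antisymm (Submodule.span_le.2 fun x hx => ⟨hx.1.1, hx.2⟩) fun y hy => ?_
  obtain ⟨hy, hy0⟩ := hy
  have hy0 : φ i y = 0 := hy0
  obtain ⟨t, -, ht⟩ := exists_nonneg_add_smul φ y p
  have h1 : y + t • p ∈ {x ∈ ineqCone L φ | φ i x = 0} := by
    have h00 : φ i (y + t • p) = 0 := by simp [hy0, h0]
    refine ⟨⟨L.add_mem hy (L.smul_mem _ hp), fun j => ?_⟩, h00⟩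
    by_cases hj : φ j = φ i
    · rw [hj, h00]
    · exact ht j (hpos j hj)
  have h2 : p ∈ {x ∈ ineqCone L φ | φ i x = 0} := by
    refine ⟨⟨hp, fun j => ?_⟩, h0⟩
    by_cases hj : φ j = φ i
    · rw [hj, h0]
    · exact (hpos j hj).le
  have h3 := Submodule.sub_mem _ (Submodule.subset_span h1)
    (Submodule.smul_mem _ t (Submodule.subset_span h2))
  simpa using h3

theorem finrank_inf_ker [FiniteDimensional ℝ E] {l : Module.Dual ℝ E} {z : E} (hz : z ∈ L)
    (hl : l z ≠ 0) :
    Module.finrank ℝ ↥(L ⊓ LinearMap.ker l) + 1 = Module.finrank ℝ L := by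
  have h1 : l.domRestrict L ≠ 0 := fun h => hl (by simpa using LinearMap.congr_fun h ⟨z, hz⟩)
  rw [← Module.Dual.finrank_ker_add_one_of_ne_zero h1]
  congr 1
  have h2 : L ⊓ LinearMap.ker l = (LinearMap.ker (l.domRestrict L)).map L.subtype := by
    ext x
    simp only [Submodule.mem_inf, LinearMap.mem_ker, Submodule.mem_map]
    constructor
    · rintro ⟨hx, hx0⟩
      exact ⟨⟨x, hx⟩, hx0, rfl⟩
    · rintro ⟨y, hy, rfl⟩
      exact ⟨y.2, hy⟩
  rw [h2]
  exact Submodule.finrank_map_subtype_eq L _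

theorem isConeFacet_tight [Finite ι] [FiniteDimensional ℝ E] {i : ι} {z p : E} (hz : z ∈ L)
    (hzpos : ∀ j, 0 < φ j z) (hp : p ∈ L) (h0 : φ i p = 0)
    (hpos : ∀ j, φ j ≠ φ i → 0 < φ j p) :
    IsConeFacet (ineqCone L φ) {x ∈ ineqCone L φ | φ i x = 0} := by
  refine ⟨⟨φ i, fun x hx => hx.2 i, rfl⟩, ?_⟩
  rw [span_tight hp h0 hpos, span_ineqCone hz hzpos]
  exact finrank_inf_ker hz (hzpos i).ne'

/-- A facet on which no inequality is tight throughout would contain a point at which all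
inequalities are strict, and a form that is non-negative on the cone and vanishes at such a point
vanishes on `L`. So the facet lies in some tight part, and equality of dimensions makes the two
equal. -/
theorem exists_eq_tight_of_isConeFacet [Finite ι] [FiniteDimensional ℝ E] {z : E} (hz : z ∈ L)
    (hzpos : ∀ j, 0 < φ j z)
    (hp : ∀ i, ∃ p ∈ L, φ i p = 0 ∧ ∀ j, φ j ≠ φ i → 0 < φ j p) {F : Set E}
    (hF : IsConeFacet (ineqCone L φ) F) :
    ∃ i, F = {x ∈ ineqCone L φ | φ i x = 0} := by
  obtain ⟨⟨l, hl, rfl⟩, hrank⟩ := hF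
  obtain ⟨i, hi⟩ : ∃ i, ∀ x ∈ {x ∈ ineqCone L φ | l x = 0}, φ i x = 0 := by
    by_contra! hcon
    choose x hx hne using hcon
    have := Fintype.ofFinite ι
    set y := ∑ i, x i with hy
    have hyL : y ∈ L := L.sum_mem fun i _ => (hx i).1.1
    have hypos : ∀ i, 0 < φ i y := by
      intro i
      rw [hy, map_sum]
      exact Finset.sum_pos' (fun j _ => (hx j).1.2 i)
        ⟨i, Finset.mem_univ _, lt_of_le_of_ne ((hx i).1.2 i) (hne i).symm⟩
    have hly : l y = 0 := by
      rw [hy, map_sum]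
      exact Finset.sum_eq_zero fun i _ => (hx i).2
    have hnonneg : ∀ w ∈ L, 0 ≤ l w := by
      intro w hw
      obtain ⟨t, -, ht⟩ := exists_nonneg_add_smul φ w y
      have h1 := hl (w + t • y) ⟨L.add_mem hw (L.smul_mem _ hyL), fun i => ht i (hypos i)⟩
      simpa [hly] using h1
    -- `l` vanishes on `L`, so the face is the whole cone, which does not have codimension `1`
    have hFC : {x ∈ ineqCone L φ | l x = 0} = ineqCone L φ := by
      refine Set.sep_eq_self_iff_mem_true.2 fun w hw => ?_
      have h1 := hnonneg (-w) (L.neg_mem hw.1)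
      rw [map_neg] at h1
      linarith [hl w hw]
    rw [hFC] at hrank
    omega
  obtain ⟨p, hpL, hp0, hppos⟩ := hp i
  have hsub : {x ∈ ineqCone L φ | l x = 0} ⊆ {x ∈ ineqCone L φ | φ i x = 0} :=
    fun x hx => ⟨hx.1, hi x hx⟩
  have hspan : Submodule.span ℝ {x ∈ ineqCone L φ | l x = 0} =
      Submodule.span ℝ {x ∈ ineqCone L φ | φ i x = 0} := by
    refine Submodule.eq_of_le_of_finrank_eq (Submodule.span_mono hsub) ?_
    have := (isConeFacet_tight hz hzpos hpL hp0 hppos).2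
    omega
  refine ⟨i, hsub.antisymm fun x hx => ⟨hx.1, ?_⟩⟩
  have hker : Submodule.span ℝ {x ∈ ineqCone L φ | l x = 0} ≤ LinearMap.ker l :=
    Submodule.span_le.2 fun x hx => hx.2
  exact hker (hspan ▸ Submodule.subset_span hx)

/-- A point `-z + t p` with `z` interior, `p` tight only for `φ i`, and `t` large violates the
inequality of `φ i` alone. -/
theorem exists_violating [Finite ι] {i : ι} {z p : E} (hz : z ∈ L) (hzpos : ∀ j, 0 < φ j z)
    (hp : p ∈ L) (h0 : φ i p = 0) (hpos : ∀ j, φ j ≠ φ i → 0 < φ j p) :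
    ∃ x ∈ L, φ i x < 0 ∧ ∀ j, φ j ≠ φ i → 0 ≤ φ j x := by
  obtain ⟨t, -, ht⟩ := exists_nonneg_add_smul φ (-z) p
  exact ⟨-z + t • p, L.add_mem (L.neg_mem hz) (L.smul_mem _ hp), by simp [h0, hzpos i],
    fun j hj => ht j (hpos j hj)⟩

end Cone

/-! ### Second differences and the modularity equations -/

section Differences

theorem IsIneqIndex.notMem {V : Type*} {G : SimpleGraph V} {u v : V} {X : Finset V}
    (hi : IsIneqIndex G u v X) : u ∉ X ∧ v ∉ X :=
  ⟨fun hu => G.irrefl (hi.2 hu).1, fun hv => G.irrefl (hi.2 hv).2⟩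

variable {V : Type*} [DecidableEq V]

/-- The second difference `h ↦ h_{X ∪ u} + h_{X ∪ v} - h_X - h_{X ∪ {u, v}}`, which is
non-negative on submodular functions. It is used for distinct `u, v ∉ X`. -/
def secondDiff (u v : V) (X : Finset V) : Module.Dual ℝ (Finset V → ℝ) :=
  coordForm (insert u X) + coordForm (insert v X) - coordForm X - coordForm (insert u (insert v X))

theorem secondDiff_apply (u v : V) (X : Finset V) (h : Finset V → ℝ) :
    secondDiff u v X h = h (insert u X) + h (insert v X) - h X - h (insert u (insert v X)) :=
  rfl

theorem secondDiff_apply' (u v : V) (X : Finset V) (h : Finset V → ℝ) :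
    secondDiff u v X h = h (X ∪ {u}) + h (X ∪ {v}) - (h X + h (X ∪ {u, v})) := by
  rw [secondDiff_apply, Finset.union_insert, Finset.union_singleton, Finset.union_singleton,
    sub_sub]

theorem secondDiff_comm (u v : V) (X : Finset V) : secondDiff u v X = secondDiff v u X := by
  ext h
  simp [secondDiff_apply, Finset.insert_comm u v, add_comm]

theorem secondDiff_eq_of_key {u v u' v' : V} {X X' : Finset V} (he : s(u, v) = s(u', v'))
    (hX : X = X') : secondDiff u v X = secondDiff u' v' X' := by
  subst hX
  rcases Sym2.eq_iff.1 he with ⟨rfl, rfl⟩ | ⟨rfl, rfl⟩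
  · rfl
  · exact secondDiff_comm _ _ _

/-- The third difference in the directions `u, v, w` is symmetric. -/
theorem secondDiff_insert_sub (u v w : V) (X : Finset V) (h : Finset V → ℝ) :
    secondDiff u v (insert w X) h - secondDiff u v X h =
      secondDiff u w (insert v X) h - secondDiff u w X h := by
  simp only [secondDiff_apply, Finset.insert_comm w v]
  ring

/-- The fourth difference in the directions `u, v, a, b` is symmetric. -/
theorem secondDiff_insert_insert (u v a b : V) (X : Finset V) (h : Finset V → ℝ) :
    secondDiff u v (insert a (insert b X)) h - secondDiff u v (insert a X) h
        - secondDiff u v (insert b X) h + secondDiff u v X h =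
      secondDiff a b (insert u (insert v X)) h - secondDiff a b (insert u X) h
        - secondDiff a b (insert v X) h + secondDiff a b X h := by
  simp only [secondDiff_apply, Finset.insert_comm b u, Finset.insert_comm b v,
    Finset.insert_comm a u, Finset.insert_comm a v]
  ring

/-- The modularity equations of a graph, as vanishing second differences at its non-edges, for the
sets `X ∪ {u, v}` with a given `X`. -/
def IsModularAt (G : SimpleGraph V) (h : Finset V → ℝ) (X : Finset V) : Prop :=
  ∀ u v : V, u ∉ X → v ∉ X → u ≠ v → ¬ G.Adj u v → secondDiff u v X h = 0

/-- All modularity equations of a graph. -/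
def IsModularOffEdges (G : SimpleGraph V) (h : Finset V → ℝ) : Prop :=
  ∀ X : Finset V, IsModularAt G h X

/-- A function on the subsets of `V` is submodular if its second differences are non-negative. -/
def IsSubmodular (h : Finset V → ℝ) : Prop :=
  ∀ (X : Finset V) (u v : V), u ∉ X → v ∉ X → u ≠ v → 0 ≤ secondDiff u v X h

variable {G : SimpleGraph V} {h : Finset V → ℝ}

theorem modularity_iff {S : Finset V} {u v : V} (hu : u ∈ S) (hv : v ∈ S) (huv : u ≠ v) :
    h (S \ {u}) + h (S \ {v}) = h S + h (S \ {u, v}) ↔ secondDiff u v (S \ {u, v}) h = 0 := by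
  have h1 : insert u (S \ {u, v}) = S \ {v} := by grind
  have h2 : insert v (S \ {u, v}) = S \ {u} := by grind
  have h3 : insert u (S \ {u}) = S := by grind
  rw [secondDiff_apply, h1, h2, h3]
  constructor <;> intro <;> linarith

/-- The step from the chosen non-edge `{u, b}` to a non-edge `{u, v}` of the same set. -/
theorem secondDiff_eq_zero_of_common_vertex {X Y : Finset V} {u v b : V}
    (hS : insert u (insert v X) = insert u (insert b Y)) (hu : u ∉ X) (hv : v ∉ X) (huv : u ≠ v)
    (huY : u ∉ Y) (hb : b ∉ Y) (hub : u ≠ b) (hadj : ¬ G.Adj u v) (hnadj : ¬ G.Adj u b)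
    (ih : ∀ Z : Finset V, Z.card < X.card → IsModularAt G h Z) (h0 : secondDiff u b Y h = 0) :
    secondDiff u v X h = 0 := by
  have hXY : insert v X = insert b Y := by
    rw [← Finset.erase_insert (a := u) (s := insert v X) (by simp [huv, hu]), hS,
      Finset.erase_insert (by simp [hub, huY])]
  by_cases hbv : b = v
  · subst hbv
    rwa [← Finset.erase_insert hv, hXY, Finset.erase_insert hb]
  obtain ⟨Z, hZ⟩ : ∃ Z, Z = X.erase b := ⟨_, rfl⟩
  have hbX : b ∈ X := Finset.mem_of_mem_insert_of_ne (hXY ▸ Finset.mem_insert_self b Y) hbv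
  have hX : insert b Z = X := by rw [hZ, Finset.insert_erase hbX]
  have hY : insert v Z = Y := by
    rw [← Finset.erase_insert hb, ← hXY, Finset.erase_insert_of_ne (Ne.symm hbv), hZ]
  have huZ : u ∉ Z := fun h => hu (hX ▸ Finset.mem_insert_of_mem h)
  have hvZ : v ∉ Z := fun h => hv (hX ▸ Finset.mem_insert_of_mem h)
  have hbZ : b ∉ Z := hZ ▸ Finset.notMem_erase b X
  have hmod := ih Z (hZ ▸ Finset.card_erase_lt_of_mem hbX)
  have h1 := secondDiff_insert_sub u v b Z h
  rw [hX, hY, h0, hmod u v huZ hvZ huv hadj, hmod u b huZ hbZ hub hnadj] at h1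
  linarith

/-- The step from the chosen non-edge `{a, b}` to a disjoint non-edge `{u, v}` of the same set. -/
theorem secondDiff_eq_zero_of_disjoint {X Y : Finset V} {u v a b : V}
    (hS : insert u (insert v X) = insert a (insert b Y)) (hu : u ∉ X) (hv : v ∉ X) (huv : u ≠ v)
    (ha : a ∉ Y) (hb : b ∉ Y) (hab : a ≠ b) (hau : a ≠ u) (hav : a ≠ v) (hbu : b ≠ u)
    (hbv : b ≠ v) (hadj : ¬ G.Adj u v) (hnadj : ¬ G.Adj a b)
    (ih : ∀ Z : Finset V, Z.card < X.card → IsModularAt G h Z) (h0 : secondDiff a b Y h = 0) :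
    secondDiff u v X h = 0 := by
  obtain ⟨Z, hX, hY, huZ, hvZ, haZ, hbZ⟩ : ∃ Z, X = insert a (insert b Z) ∧
      Y = insert u (insert v Z) ∧ u ∉ Z ∧ v ∉ Z ∧ a ∉ Z ∧ b ∉ Z := by
    clear ih h0
    have hmem : ∀ w, (w = u ∨ w = v ∨ w ∈ X) ↔ (w = a ∨ w = b ∨ w ∈ Y) := fun w => by
      simpa using Finset.ext_iff.1 hS w
    clear hS
    refine ⟨X \ {a, b}, ?_, ?_, by simp [hu], by simp [hv], by simp, by simp⟩ <;> ext w <;>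
      simp only [Finset.mem_insert, Finset.mem_sdiff, Finset.mem_singleton] <;> grind
  have hcard : X.card = Z.card + 1 + 1 := by
    rw [hX, Finset.card_insert_of_notMem (by simp [hab, haZ]), Finset.card_insert_of_notMem hbZ]
  have hmod : ∀ w, IsModularAt G h (insert w Z) := fun w =>
    ih _ ((Finset.card_insert_le w Z).trans_lt (by omega))
  have hmodZ : IsModularAt G h Z := ih Z (by omega)
  have h1 := secondDiff_insert_insert u v a b Z h
  rw [← hX, ← hY, h0,
    hmod a u v (by simp [hau.symm, huZ]) (by simp [hav.symm, hvZ]) huv hadj,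
    hmod b u v (by simp [hbu.symm, huZ]) (by simp [hbv.symm, hvZ]) huv hadj,
    hmodZ u v huZ hvZ huv hadj,
    hmod u a b (by simp [hau, haZ]) (by simp [hbu, hbZ]) hab hnadj,
    hmod v a b (by simp [hav, haZ]) (by simp [hbv, hbZ]) hab hnadj,
    hmodZ a b haZ hbZ hab hnadj] at h1
  linarith

/-- One vanishing second difference for each non-clique suffices. By induction on the size of `X`,
the second differences at non-edges of smaller sets vanish; the symmetry of third differences (if
the two non-edges share a vertex) and of fourth differences (if they are disjoint) then carries the
equation from the chosen non-edge of `X ∪ {u, v}` to the non-edge `{u, v}`. -/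
theorem isModularOffEdges_of_choice
    (hc : ∀ S : Finset V, ¬ G.IsClique (S : Set V) → ∃ (a b : V) (Y : Finset V),
      S = insert a (insert b Y) ∧ a ∉ Y ∧ b ∉ Y ∧ a ≠ b ∧ ¬ G.Adj a b ∧ secondDiff a b Y h = 0) :
    IsModularOffEdges G h := by
  have key : ∀ (n : ℕ) (X : Finset V), X.card = n → IsModularAt G h X := by
    intro n
    induction n using Nat.strong_induction_on with
    | _ n ihn =>
    intro X hX u v hu hv huv hadj
    have ih : ∀ Z : Finset V, Z.card < X.card → IsModularAt G h Z :=
      fun Z hZ => ihn _ (hX ▸ hZ) Z rfl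
    obtain ⟨a, b, Y, hS, ha, hb, hab, hnadj, h0⟩ := hc (insert u (insert v X)) fun hcl =>
      hadj (hcl (by simp) (by simp) huv)
    have hadj' : ¬ G.Adj v u := fun h => hadj h.symm
    have hnadj' : ¬ G.Adj b a := fun h => hnadj h.symm
    by_cases hau : a = u
    · subst hau
      exact secondDiff_eq_zero_of_common_vertex hS hu hv huv ha hb hab hadj hnadj ih h0
    by_cases hav : a = v
    · subst hav
      rw [Finset.insert_comm] at hS
      rw [secondDiff_comm]
      exact secondDiff_eq_zero_of_common_vertex hS hv hu huv.symm ha hb hab hadj' hnadj ih h0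
    by_cases hbu : b = u
    · subst hbu
      rw [Finset.insert_comm a] at hS
      rw [secondDiff_comm] at h0
      exact secondDiff_eq_zero_of_common_vertex hS hu hv huv hb ha hab.symm hadj hnadj' ih h0
    by_cases hbv : b = v
    · subst hbv
      rw [Finset.insert_comm, Finset.insert_comm a] at hS
      rw [secondDiff_comm] at h0 ⊢
      exact secondDiff_eq_zero_of_common_vertex hS hv hu huv.symm hb ha hab.symm hadj' hnadj' ih h0
    exact secondDiff_eq_zero_of_disjoint hS hu hv huv ha hb hab hau hav hbu hbv hadj hnadj ih h0
  exact fun X => key _ X rfl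

/-- Second differences do not see the vertices outside the common neighbourhood. -/
theorem secondDiff_union_eq (hh : IsModularOffEdges G h) {u v : V} (huv : u ≠ v) {Y : Finset V}
    (A : Finset V) (hu : u ∉ Y ∪ A) (hv : v ∉ Y ∪ A)
    (hA : ∀ w ∈ A, ¬ (G.Adj u w ∧ G.Adj v w)) :
    secondDiff u v (Y ∪ A) h = secondDiff u v Y h := by
  induction A using Finset.induction_on with
  | empty => simp
  | insert w A hw ih =>
    rw [← ih (by grind) (by grind) (by grind), Finset.union_insert]
    by_cases hwY : w ∈ Y ∪ A
    · rw [Finset.insert_eq_of_mem hwY]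
    have hwu : w ≠ u := by grind
    have hwv : w ≠ v := by grind
    rw [← sub_eq_zero]
    by_cases huw : G.Adj u w
    · have hvw : ¬ G.Adj v w := fun hvw => hA w (by simp) ⟨huw, hvw⟩
      rw [secondDiff_comm u v, secondDiff_comm u v, secondDiff_insert_sub,
        hh _ v w (by grind) (by grind) hwv.symm hvw, hh _ v w (by grind) (by grind) hwv.symm hvw,
        sub_zero]
    · rw [secondDiff_insert_sub,
        hh _ u w (by grind) (by grind) hwu.symm huw, hh _ u w (by grind) (by grind) hwu.symm huw,
        sub_zero]

theorem isSubmodular_of_isIneqIndex (hh : IsModularOffEdges G h)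
    (hi : ∀ u v X, IsIneqIndex G u v X → 0 ≤ secondDiff u v X h) : IsSubmodular h := by
  classical
  intro X u v hu hv huv
  by_cases hadj : G.Adj u v
  · have h1 := secondDiff_union_eq hh huv (Y := X.filter fun w => G.Adj u w ∧ G.Adj v w)
      (X.filter fun w => ¬ (G.Adj u w ∧ G.Adj v w)) (by grind) (by grind) (by grind)
    rw [Finset.filter_union_filter_not_eq] at h1
    rw [h1]
    refine hi u v _ ⟨hadj, fun w hw => ?_⟩
    simpa using (Finset.mem_filter.1 hw).2
  · exact (hh X u v hu hv huv hadj).ge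

/-- The height vector that is `1` on the sets containing `K` and `-1` on the others. -/
def supersetHeight (K : Finset V) : Finset V → ℝ :=
  fun S => if K ⊆ S then 1 else -1

theorem secondDiff_supersetHeight (K : Finset V) {a b : V} {X : Finset V} (ha : a ∉ X)
    (hb : b ∉ X) (hab : a ≠ b) :
    secondDiff a b X (supersetHeight K) =
      if a ∈ K ∧ b ∈ K ∧ K ⊆ insert a (insert b X) then -2 else 0 := by
  simp only [secondDiff_apply, supersetHeight]
  have h1 : K ⊆ insert a X ↔ b ∉ K ∧ K ⊆ insert a (insert b X) := by grind
  have h2 : K ⊆ insert b X ↔ a ∉ K ∧ K ⊆ insert a (insert b X) := by grind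
  have h3 : K ⊆ X ↔ a ∉ K ∧ b ∉ K ∧ K ⊆ insert a (insert b X) := by grind
  simp only [h1, h2, h3]
  by_cases h4 : a ∈ K <;> by_cases h5 : b ∈ K <;> by_cases h6 : K ⊆ insert a (insert b X) <;>
    simp [h4, h5, h6]
  norm_num

end Differences

section Equations

variable {V : Type*} [Fintype V] [DecidableEq V] {G : SimpleGraph V} {h : Finset V → ℝ}

theorem mem_equationSpace_iff :
    h ∈ equationSpace G ↔ h ∅ = -h Finset.univ ∧ IsModularOffEdges G h := by
  refine and_congr_right fun _ => ⟨fun hS X u v hu hv huv hadj => ?_,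
    fun hm S u v hu hv huv hadj => ?_⟩
  · have h1 := (modularity_iff (by simp) (by simp) huv).1
      (hS (insert u (insert v X)) u v (by simp) (by simp) huv hadj)
    rwa [show insert u (insert v X) \ {u, v} = X by grind] at h1
  · exact (modularity_iff hu hv huv).2 (hm _ u v (by grind) (by grind) huv hadj)

theorem chosenForm_some (c : Finset V → V × V)
    (S : {S : Finset V // ¬ G.IsClique (S : Set V)}) (hc : IsNonEdgeChoice G c) :
    chosenForm G c (some S) = -secondDiff (c S).1 (c S).2 (S.1 \ {(c S).1, (c S).2}) := by
  obtain ⟨h1, h2, h3, -⟩ := hc S.1 S.2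
  have e1 : insert (c S).1 (S.1 \ {(c S).1, (c S).2}) = S.1 \ {(c S).2} := by grind
  have e2 : insert (c S).2 (S.1 \ {(c S).1, (c S).2}) = S.1 \ {(c S).1} := by grind
  have e3 : insert (c S).1 (S.1 \ {(c S).1}) = S.1 := by grind
  rw [chosenForm, secondDiff, e1, e2, e3]
  abel

theorem chosenForm_zeros (c : Finset V → V × V) (hc : IsNonEdgeChoice G c) :
    {h | ∀ i, chosenForm G c i h = 0} = equationSpace G := by
  ext h
  rw [mem_equationSpace_iff, Set.mem_ofPred_eq, Option.forall]
  refine and_congr ?_ ⟨fun hS => ?_, fun hm S => ?_⟩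
  · simp [chosenForm, coordForm, eq_neg_iff_add_eq_zero]
  · refine isModularOffEdges_of_choice fun S hcl => ?_
    obtain ⟨h1, h2, h3, h4⟩ := hc S hcl
    refine ⟨(c S).1, (c S).2, S \ {(c S).1, (c S).2}, by grind, by grind, by grind, h3, h4, ?_⟩
    have h5 := hS ⟨S, hcl⟩
    rwa [chosenForm_some c _ hc, LinearMap.neg_apply, neg_eq_zero] at h5
  · obtain ⟨h1, h2, h3, h4⟩ := hc S.1 S.2
    rw [chosenForm_some c _ hc, LinearMap.neg_apply, neg_eq_zero]
    exact hm _ _ _ (by grind) (by grind) h3 h4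

/-- The constant function `1` isolates the form `h_∅ + h_V`, and the modularity form of `S` has
`h_S` as its only coordinate at a set of size at least `|S|`, so that a set of maximal size in a
linear relation leads to a contradiction. -/
theorem linearIndependent_chosenForm (c : Finset V → V × V) (hc : IsNonEdgeChoice G c) :
    LinearIndependent ℝ (chosenForm G c) := by
  classical
  rw [Fintype.linearIndependent_iff]
  intro g hg
  have heval : ∀ h : Finset V → ℝ, g none * (h ∅ + h Finset.univ) +
      ∑ S, g (some S) * chosenForm G c (some S) h = 0 := by
    intro h
    have := LinearMap.congr_fun hg h
    simpa [Fintype.sum_option, LinearMap.sum_apply, chosenForm, coordForm, mul_add] using this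
  have hnone : g none = 0 := by
    have h1 := heval fun _ => 1
    rw [Finset.sum_eq_zero] at h1
    · norm_num at h1
      exact h1
    · intro S _
      simp [chosenForm, coordForm]
  suffices hs : ∀ S, g (some S) = 0 by
    intro i
    cases i with
    | none => exact hnone
    | some S => exact hs S
  by_contra! hne
  obtain ⟨S, hS, hmax⟩ := Finset.exists_max_image (Finset.univ.filter fun S => g (some S) ≠ 0)
    (fun S => S.1.card) (by obtain ⟨S, hS⟩ := hne; exact ⟨S, by simpa using hS⟩)
  have hgS : g (some S) ≠ 0 := by simpa using hS
  have h1 := heval (Pi.single S.1 1)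
  rw [hnone, zero_mul, zero_add, Finset.sum_eq_single S] at h1
  · obtain ⟨h2, h3, h4, -⟩ := hc S.1 S.2
    have e1 : S.1 \ {(c S).1, (c S).2} ≠ S.1 := by grind
    have e2 : S.1 \ {(c S).1} ≠ S.1 := by grind
    have e3 : S.1 \ {(c S).2} ≠ S.1 := by grind
    simp [chosenForm, coordForm, e1, e2, e3] at h1
    exact hgS h1
  · intro T _ hTS
    by_cases hT : g (some T) = 0
    · simp [hT]
    · have hle := hmax T (by simpa using hT)
      have hTS' : T.1 ≠ S.1 := fun h => hTS (Subtype.ext h)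
      obtain ⟨h2, h3, h4, -⟩ := hc T.1 T.2
      have small : ∀ A : Finset V, (c T).1 ∈ A ∨ (c T).2 ∈ A → T.1 \ A ≠ S.1 := by
        intro A hA hAS
        have : T.1 \ A ⊂ T.1 := by
          refine ⟨Finset.sdiff_subset, fun hsub => ?_⟩
          rcases hA with hA | hA
          · exact (Finset.mem_sdiff.1 (hsub h2)).2 hA
          · exact (Finset.mem_sdiff.1 (hsub h3)).2 hA
        have := Finset.card_lt_card this
        rw [hAS] at this
        omega
      simp [chosenForm, coordForm, hTS', small]
  · simp

/-- The linear space of height vectors satisfying the equations. -/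
def equationSubmodule (G : SimpleGraph V) : Submodule ℝ (Finset V → ℝ) where
  carrier := equationSpace G
  add_mem' := by
    intro a b ha hb
    rw [mem_equationSpace_iff] at *
    refine ⟨by simp only [Pi.add_apply]; linarith [ha.1, hb.1], fun X u v h1 h2 h3 h4 => ?_⟩
    rw [map_add, ha.2 X u v h1 h2 h3 h4, hb.2 X u v h1 h2 h3 h4, add_zero]
  zero_mem' := by
    rw [mem_equationSpace_iff]
    exact ⟨by simp, fun X u v _ _ _ _ => map_zero _⟩
  smul_mem' := by
    intro r a ha
    rw [mem_equationSpace_iff] at *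
    refine ⟨by simp [ha.1], fun X u v h1 h2 h3 h4 => ?_⟩
    rw [map_smul, ha.2 X u v h1 h2 h3 h4, smul_zero]

theorem mem_equationSubmodule :
    h ∈ equationSubmodule G ↔ h ∅ = -h Finset.univ ∧ IsModularOffEdges G h :=
  mem_equationSpace_iff

/-- The triples `(u, v, S)` indexing the inequalities, with `{u, v}` ordered in both ways. -/
abbrev IneqIndex (G : SimpleGraph V) : Type _ :=
  {t : V × V × Finset V // IsIneqIndex G t.1 t.2.1 t.2.2}

/-- The linear form whose non-negativity is the inequality with the given index. -/
def ineqForm (G : SimpleGraph V) (i : IneqIndex G) : Module.Dual ℝ (Finset V → ℝ) :=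
  secondDiff i.1.1 i.1.2.1 i.1.2.2

theorem heightCone_eq : heightCone G = ineqCone (equationSubmodule G) (ineqForm G) := by
  ext h
  refine and_congr Iff.rfl ⟨fun hi i => ?_, fun hi u v X hX => ?_⟩
  · have := hi _ _ _ i.2
    rw [ineqForm, secondDiff_apply']
    linarith
  · have := hi ⟨(u, v, X), hX⟩
    rw [ineqForm, secondDiff_apply'] at this
    linarith

theorem tightPart_eq {u v : V} {X : Finset V} (hX : IsIneqIndex G u v X) :
    tightPart G u v X =
      {h ∈ ineqCone (equationSubmodule G) (ineqForm G) | ineqForm G ⟨(u, v, X), hX⟩ h = 0} := by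
  ext h
  rw [tightPart, heightCone_eq]
  refine and_congr Iff.rfl ?_
  rw [ineqForm, secondDiff_apply', sub_eq_zero, eq_comm]

theorem isSubmodular_of_mem_heightCone (hh : h ∈ heightCone G) : IsSubmodular h := by
  rw [heightCone_eq] at hh
  exact isSubmodular_of_isIneqIndex (mem_equationSubmodule.1 hh.1).2
    fun u v X hX => hh.2 ⟨(u, v, X), hX⟩

theorem mem_heightCone_of_isSubmodular (h0 : h ∅ = -h Finset.univ) (hm : IsModularOffEdges G h)
    (hs : IsSubmodular h) : h ∈ heightCone G := by
  rw [heightCone_eq]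
  exact ⟨mem_equationSubmodule.2 ⟨h0, hm⟩,
    fun i => hs _ _ _ i.2.notMem.1 i.2.notMem.2 i.2.1.ne⟩

/-! ### Strictly submodular height vectors with at most one tight inequality -/

/-- The height vector of the segment `[e_u, e_v]`: the value at `S` is the maximum of the signed sum
over the two endpoints. -/
def edgeHeight (e : Sym2 V) : Finset V → ℝ :=
  fun S => if ∃ v ∈ e, v ∈ S then 1 else -1

theorem edgeHeight_mk (u v : V) (S : Finset V) :
    edgeHeight s(u, v) S = if u ∈ S ∨ v ∈ S then 1 else -1 := by
  simp [edgeHeight]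

theorem secondDiff_edgeHeight (e : Sym2 V) {a b : V} {X : Finset V} (ha : a ∉ X) (hb : b ∉ X)
    (hab : a ≠ b) : secondDiff a b X (edgeHeight e) = if e = s(a, b) then 2 else 0 := by
  induction e with
  | _ u v =>
    simp only [secondDiff_apply, edgeHeight_mk, Finset.mem_insert, Sym2.eq_iff]
    by_cases h1 : u ∈ X <;> by_cases h2 : v ∈ X <;> by_cases h3 : u = a <;>
      by_cases h4 : v = b <;> by_cases h5 : u = b <;> by_cases h6 : v = a <;>
      simp_all <;> norm_num

theorem edgeHeight_mem {e : Sym2 V} (he : e ∈ G.edgeSet) :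
    edgeHeight e ∈ equationSubmodule G := by
  rw [mem_equationSubmodule]
  refine ⟨?_, fun X u v hu hv huv hadj => ?_⟩
  · induction e with
    | _ u v => simp [edgeHeight_mk]
  · rw [secondDiff_edgeHeight e hu hv huv, if_neg]
    rintro rfl
    exact hadj he

/-- The height vector of the graphical zonotope. -/
def zonotopeHeight (G : SimpleGraph V) [DecidableRel G.Adj] : Finset V → ℝ :=
  ∑ e ∈ G.edgeFinset, edgeHeight e

theorem secondDiff_zonotopeHeight [DecidableRel G.Adj] {a b : V} {X : Finset V} (ha : a ∉ X)
    (hb : b ∉ X) (hab : a ≠ b) :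
    secondDiff a b X (zonotopeHeight G) = if G.Adj a b then 2 else 0 := by
  simp [zonotopeHeight, secondDiff_edgeHeight _ ha hb hab]

theorem zonotopeHeight_mem [DecidableRel G.Adj] : zonotopeHeight G ∈ equationSubmodule G :=
  Submodule.sum_mem _ fun _ he => edgeHeight_mem (SimpleGraph.mem_edgeFinset.1 he)

theorem ineqForm_zonotopeHeight_pos [DecidableRel G.Adj] (i : IneqIndex G) :
    0 < ineqForm G i (zonotopeHeight G) := by
  rw [ineqForm, secondDiff_zonotopeHeight i.2.notMem.1 i.2.notMem.2 i.2.1.ne, if_pos i.2.1]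
  norm_num

theorem supersetHeight_mem {K : Finset V} (hK : G.IsClique (K : Set V)) (hne : K.Nonempty) :
    supersetHeight K ∈ equationSubmodule G := by
  rw [mem_equationSubmodule]
  refine ⟨?_, fun X u v hu hv huv hadj => ?_⟩
  · simp [supersetHeight, Finset.subset_empty, hne.ne_empty]
  · rw [secondDiff_supersetHeight K hu hv huv, if_neg]
    rintro ⟨h1, h2, -⟩
    exact hadj (hK h1 h2 huv)

/-- On the subsets `X` of the common neighbourhood `W` of `u` and `v`, the second difference of `p`
in the direction `{u, v}` is twice the size of the symmetric difference of `X` and `S`. The summand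
of `p` over the edges other than `{u, v}` makes the second differences at those edges positive. -/
theorem exists_only_tight [DecidableRel G.Adj] {u v : V} {S : Finset V}
    (hS : IsIneqIndex G u v S) :
    ∃ p ∈ equationSubmodule G, secondDiff u v S p = 0 ∧
      ∀ a b X, IsIneqIndex G a b X → ¬ (s(a, b) = s(u, v) ∧ X = S) → 0 < secondDiff a b X p := by
  set W : Finset V := Finset.univ.filter fun w => G.Adj u w ∧ G.Adj v w with hW
  set ε : V → ℝ := fun w => if w ∈ S then 1 else -1 with hε
  -- the triangles containing `{u, v}`, with signs that make the size of `X ∩ S` count negatively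
  set q : Finset V → ℝ := ∑ w ∈ W, ε w • supersetHeight {u, v, w} with hq
  set p : Finset V → ℝ := q + (S.card : ℝ) • edgeHeight s(u, v) +
    (Fintype.card V + 1 : ℝ) • ∑ e ∈ G.edgeFinset.erase s(u, v), edgeHeight e with hp
  have huv : u ≠ v := hS.1.ne
  have hqD : ∀ a b X, a ∉ X → b ∉ X → a ≠ b → secondDiff a b X q =
      ∑ w ∈ W, ε w * if a ∈ ({u, v, w} : Finset V) ∧ b ∈ ({u, v, w} : Finset V) ∧
        {u, v, w} ⊆ insert a (insert b X) then -2 else 0 := by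
    intro a b X ha hb hab
    simp [hq, secondDiff_supersetHeight _ ha hb hab]
  have hpD : ∀ a b X, a ∉ X → b ∉ X → G.Adj a b → secondDiff a b X p =
      secondDiff a b X q + if s(a, b) = s(u, v) then 2 * (S.card : ℝ)
        else 2 * (Fintype.card V + 1 : ℝ) := by
    intro a b X ha hb hab
    simp only [hp, map_add, map_smul, map_sum, secondDiff_edgeHeight _ ha hb hab.ne,
      Finset.sum_ite_eq', Finset.mem_erase, SimpleGraph.mem_edgeFinset, SimpleGraph.mem_edgeSet,
      hab, and_true, smul_eq_mul]
    by_cases h1 : s(a, b) = s(u, v)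
    · simp [h1, mul_comm]
    · simp [h1, Ne.symm h1, mul_comm]
  -- the direction `{u, v}`
  have hmain : ∀ X, IsIneqIndex G u v X →
      secondDiff u v X p = 2 * ((S \ X).card : ℝ) + 2 * ((X \ S).card : ℝ) := by
    intro X hX
    have hXW : X ⊆ W := fun w hw => by simpa [hW] using hX.2 hw
    have h1 : secondDiff u v X q = ∑ w ∈ X, -2 * ε w := by
      rw [hqD u v X hX.notMem.1 hX.notMem.2 huv, ← Finset.sum_subset hXW]
      · refine Finset.sum_congr rfl fun w hw => ?_
        rw [if_pos (by simp [Finset.insert_subset_iff, hw]), mul_comm]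
      · intro w hw hwX
        have hwu : w ≠ u := by rintro rfl; simp [hW] at hw
        have hwv : w ≠ v := by rintro rfl; simp [hW] at hw
        rw [if_neg, mul_zero]
        rintro ⟨-, -, hsub⟩
        have := hsub (show w ∈ ({u, v, w} : Finset V) by simp)
        simp [hwu, hwv, hwX] at this
    have h2 : ∑ w ∈ X, -2 * ε w = -2 * ((X ∩ S).card : ℝ) + 2 * ((X \ S).card : ℝ) := by
      rw [← Finset.sum_inter_add_sum_sdiff X S]
      congr 1
      · rw [Finset.sum_congr rfl (g := fun _ => (-2 : ℝ)) (by simp +contextual [hε])]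
        simp [mul_comm]
      · rw [Finset.sum_congr rfl (g := fun _ => (2 : ℝ)) (by simp +contextual [hε])]
        simp [mul_comm]
    have h3 : (S.card : ℝ) = ((S \ X).card : ℝ) + ((X ∩ S).card : ℝ) := by
      rw [← Finset.card_sdiff_add_card_inter S X, Finset.inter_comm]
      push_cast
      rfl
    rw [hpD u v X hX.notMem.1 hX.notMem.2 hS.1, if_pos rfl, h1, h2, h3]
    ring
  refine ⟨p, ?_, ?_, fun a b X hX hne => ?_⟩
  · refine Submodule.add_mem _ (Submodule.add_mem _ (Submodule.sum_mem _ fun w hw => ?_) ?_) ?_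
    · refine Submodule.smul_mem _ _ (supersetHeight_mem ?_ (by simp))
      have hw' : G.Adj u w ∧ G.Adj v w := by simpa [hW] using hw
      intro x hx y hy hxy
      have hx' : x = u ∨ x = v ∨ x = w := by simpa using hx
      have hy' : y = u ∨ y = v ∨ y = w := by simpa using hy
      rcases hx' with rfl | rfl | rfl <;> rcases hy' with rfl | rfl | rfl <;>
        first
        | exact absurd rfl hxy
        | exact hS.1
        | exact hS.1.symm
        | exact hw'.1
        | exact hw'.1.symm
        | exact hw'.2
        | exact hw'.2.symm
    · exact Submodule.smul_mem _ _ (edgeHeight_mem hS.1)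
    · exact Submodule.smul_mem _ _ (Submodule.sum_mem _ fun e he =>
        edgeHeight_mem (SimpleGraph.mem_edgeFinset.1 (Finset.mem_of_mem_erase he)))
  · rw [hmain S hS]
    simp
  · by_cases he : s(a, b) = s(u, v)
    · have hXS : X ≠ S := fun h => hne ⟨he, h⟩
      rw [secondDiff_eq_of_key he rfl]
      have hX' : IsIneqIndex G u v X := by
        rcases Sym2.eq_iff.1 he with ⟨rfl, rfl⟩ | ⟨rfl, rfl⟩
        · exact hX
        · exact ⟨hX.1.symm, fun w hw => ⟨(hX.2 hw).2, (hX.2 hw).1⟩⟩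
      rw [hmain X hX']
      have h1 : 0 < (S \ X).card ∨ 0 < (X \ S).card := by
        simp only [Finset.card_pos, Finset.sdiff_nonempty]
        by_contra! hcon
        exact hXS (hcon.2.antisymm hcon.1)
      rcases h1 with h1 | h1 <;> positivity
    · -- at most `|V|` summands of size at most `2` are outweighed by `2 (|V| + 1)`
      rw [hpD a b X hX.notMem.1 hX.notMem.2 hX.1, if_neg he,
        hqD a b X hX.notMem.1 hX.notMem.2 hX.1.ne]
      have h1 : ∑ w ∈ W, (-2 : ℝ) ≤ ∑ w ∈ W, ε w *
          (if a ∈ ({u, v, w} : Finset V) ∧ b ∈ ({u, v, w} : Finset V) ∧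
            {u, v, w} ⊆ insert a (insert b X) then -2 else 0) := by
        refine Finset.sum_le_sum fun w _ => ?_
        simp only [hε]
        split_ifs <;> norm_num
      have h2 : (W.card : ℝ) ≤ Fintype.card V := by exact_mod_cast Finset.card_le_univ W
      simp only [Finset.sum_const, nsmul_eq_mul] at h1
      linarith

end Equations

/-! ### Deformed permutahedra of submodular height vectors -/

section LinearForms

variable {V : Type*} [Fintype V]

theorem exists_order_antitone (c : V → ℝ) :
    ∃ σ : V ≃ Fin (Fintype.card V), ∀ v w, σ v ≤ σ w → c w ≤ c v := by
  let e := Fintype.equivFin V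
  let f : Fin (Fintype.card V) → ℝ := fun i => -c (e.symm i)
  refine ⟨e.trans (Tuple.sort f).symm, fun v w hvw => ?_⟩
  have := Tuple.monotone_sort f hvw
  simpa [f] using this

theorem exists_separating {Q : Set (V → ℝ)} (hQ : Convex ℝ Q) (hQ' : IsClosed Q) {x : V → ℝ}
    (hx : x ∉ Q) : ∃ c : V → ℝ, ∀ a ∈ Q, ∑ v, c v * a v < ∑ v, c v * x v := by
  classical
  obtain ⟨f, u, hfa, hfx⟩ := geometric_hahn_banach_closed_point hQ hQ' hx
  have hf : ∀ y : V → ℝ, f y = ∑ v, f (fun w => if v = w then 1 else 0) * y v := by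
    intro y
    have := LinearMap.pi_apply_eq_sum_univ (f : (V → ℝ) →ₗ[ℝ] ℝ) y
    simpa [mul_comm] using this
  refine ⟨fun v => f fun w => if v = w then 1 else 0, fun a ha => ?_⟩
  rw [← hf, ← hf]
  exact (hfa a ha).trans hfx

theorem sum_mul_add (c x y : V → ℝ) :
    ∑ v, c v * (x + y) v = ∑ v, c v * x v + ∑ v, c v * y v := by
  simp [mul_add, Finset.sum_add_distrib]

/-- The vertex `v ↦ (h {w | σ w ≤ σ v} - h {w | σ w < σ v}) / 2` of `P_h` that the greedy algorithm
produces for the linear order of `V` given by `σ`, as a linear function of `h`. -/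
noncomputable def greedyPoint (σ : V ≃ Fin (Fintype.card V)) : (Finset V → ℝ) →ₗ[ℝ] (V → ℝ) :=
  LinearMap.pi fun v => (1 / 2 : ℝ) •
    (coordForm (Finset.univ.filter fun w => σ w ≤ σ v) -
      coordForm (Finset.univ.filter fun w => σ w < σ v))

theorem greedyPoint_apply {h : Finset V → ℝ} {σ : V ≃ Fin (Fintype.card V)} (v : V) :
    greedyPoint σ h v = (h (Finset.univ.filter fun w => σ w ≤ σ v) -
      h (Finset.univ.filter fun w => σ w < σ v)) / 2 := by
  simp only [greedyPoint, LinearMap.pi_apply, LinearMap.smul_apply, LinearMap.sub_apply,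
    coordForm, LinearMap.proj_apply, smul_eq_mul]
  ring

end LinearForms

section Greedy

variable {V : Type*} [DecidableEq V] {h : Finset V → ℝ}

/-- Diminishing returns. -/
theorem IsSubmodular.marginal_le (hs : IsSubmodular h) {A B : Finset V} (hAB : A ⊆ B) {v : V}
    (hv : v ∉ B) : h (insert v B) - h B ≤ h (insert v A) - h A := by
  have key : ∀ C : Finset V, v ∉ A ∪ C →
      h (insert v (A ∪ C)) - h (A ∪ C) ≤ h (insert v A) - h A := by
    intro C
    induction C using Finset.induction_on with
    | empty => simp
    | insert w C hw ih =>
      intro hvC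
      rw [Finset.union_insert] at hvC ⊢
      have h1 := ih (fun h => hvC (Finset.mem_insert_of_mem h))
      by_cases hwC : w ∈ A ∪ C
      · rwa [Finset.insert_eq_of_mem hwC]
      · have h2 := hs (A ∪ C) v w (fun h => hvC (Finset.mem_insert_of_mem h)) hwC
          (fun h => hvC (h ▸ Finset.mem_insert_self _ _))
        rw [secondDiff_apply] at h2
        linarith
  have := key B
  rw [Finset.union_eq_right.2 hAB] at this
  exact this hv

variable [Fintype V]

/-- The signed sum `∑ v ∈ S, x v - ∑ v ∉ S, x v` bounded by `h S` on the polytope `P_h`. -/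
def signedSum (S : Finset V) (x : V → ℝ) : ℝ :=
  ∑ v ∈ S, x v - ∑ v ∈ Sᶜ, x v

theorem signedSum_eq (S : Finset V) (x : V → ℝ) :
    signedSum S x = 2 * ∑ v ∈ S, x v - ∑ v, x v := by
  rw [signedSum, ← Finset.sum_add_sum_compl S x]
  ring

theorem signedSum_add (S : Finset V) (x y : V → ℝ) :
    signedSum S (x + y) = signedSum S x + signedSum S y := by
  simp only [signedSum, Pi.add_apply, Finset.sum_add_distrib]
  ring

theorem signedSum_smul (S : Finset V) (r : ℝ) (x : V → ℝ) :
    signedSum S (r • x) = r * signedSum S x := by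
  simp only [signedSum, Pi.smul_apply, smul_eq_mul, ← Finset.mul_sum]
  ring

theorem signedSum_modular {X : Finset V} {u v : V} (hu : u ∉ X) (hv : v ∉ X) (huv : u ≠ v)
    (x : V → ℝ) :
    signedSum (insert u X) x + signedSum (insert v X) x =
      signedSum X x + signedSum (insert u (insert v X)) x := by
  simp only [signedSum_eq]
  rw [Finset.sum_insert hu, Finset.sum_insert hv, Finset.sum_insert (by simp [huv, hu]),
    Finset.sum_insert hv]
  ring

theorem sum_eq_of_mem (h0 : h ∅ = -h Finset.univ) {x : V → ℝ}
    (hx : x ∈ deformedPermutahedron h) : ∑ v, x v = h Finset.univ := by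
  have h1 := hx ∅
  have h2 := hx Finset.univ
  simp only [Finset.sum_empty, Finset.compl_empty, Finset.compl_univ] at h1 h2
  linarith

theorem mem_deformedPermutahedron_iff (h0 : h ∅ = -h Finset.univ) {x : V → ℝ} :
    x ∈ deformedPermutahedron h ↔
      ∑ v, x v = h Finset.univ ∧ ∀ S, ∑ v ∈ S, x v ≤ (h S - h ∅) / 2 := by
  constructor
  · refine fun hx => ⟨sum_eq_of_mem h0 hx, fun S => ?_⟩
    have h1 : signedSum S x ≤ h S := hx S
    rw [signedSum_eq, sum_eq_of_mem h0 hx] at h1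
    linarith
  · rintro ⟨h1, h2⟩ S
    change signedSum S x ≤ h S
    rw [signedSum_eq, h1]
    linarith [h2 S]

variable {σ : V ≃ Fin (Fintype.card V)}

/-- Initial segments of the linear order given by `σ`. -/
def IsInitial (σ : V ≃ Fin (Fintype.card V)) (S : Finset V) : Prop :=
  ∀ v ∈ S, ∀ w, σ w ≤ σ v → w ∈ S

theorem insert_filter_lt (a : V) :
    insert a (Finset.univ.filter fun w => σ w < σ a) = Finset.univ.filter fun w => σ w ≤ σ a := by
  ext w
  simp only [Finset.mem_insert, Finset.mem_filter, Finset.mem_univ, true_and, le_iff_lt_or_eq,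
    EmbeddingLike.apply_eq_iff_eq, or_comm]

/-- Induction over the initial segments of a linear order. -/
theorem IsInitial.induction {motive : Finset V → Prop} (empty : motive ∅)
    (insert : ∀ a, motive (Finset.univ.filter fun w => σ w < σ a) →
      motive (insert a (Finset.univ.filter fun w => σ w < σ a))) {S : Finset V}
    (hS : IsInitial σ S) : motive S := by
  induction S using Finset.induction_on_max_value σ with
  | empty => exact empty
  | insert a s ha hmax ih =>
    have hlt : ∀ x ∈ s, σ x < σ a := fun x hx =>
      lt_of_le_of_ne (hmax x hx) fun h => ha (σ.injective h ▸ hx)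
    have hs : s = Finset.univ.filter fun w => σ w < σ a := by
      ext w
      simp only [Finset.mem_filter, Finset.mem_univ, true_and]
      refine ⟨hlt w, fun hw => ?_⟩
      rcases Finset.mem_insert.1 (hS a (Finset.mem_insert_self _ _) w hw.le) with rfl | h
      · exact absurd hw (lt_irrefl _)
      · exact h
    have hs' : IsInitial σ s := by
      intro v hv w hw
      rw [hs]
      simpa using hw.trans_lt (hlt v hv)
    have := insert a (hs ▸ ih hs')
    rwa [← hs] at this

theorem sum_greedyPoint_of_isInitial {S : Finset V} (hS : IsInitial σ S) :
    ∑ v ∈ S, greedyPoint σ h v = (h S - h ∅) / 2 := by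
  refine hS.induction (motive := fun S => ∑ v ∈ S, greedyPoint σ h v = (h S - h ∅) / 2)
    (by simp) fun a ih => ?_
  rw [Finset.sum_insert (by simp), ih, greedyPoint_apply, ← insert_filter_lt]
  ring

theorem sum_greedyPoint_le (hs : IsSubmodular h) (S : Finset V) :
    ∑ v ∈ S, greedyPoint σ h v ≤ (h S - h ∅) / 2 := by
  induction S using Finset.induction_on_max_value σ with
  | empty => simp
  | insert a s ha hmax ih =>
    have hsub : s ⊆ Finset.univ.filter fun w => σ w < σ a := by
      intro x hx
      simpa using lt_of_le_of_ne (hmax x hx) fun h => ha (σ.injective h ▸ hx)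
    have h1 := hs.marginal_le hsub (v := a) (by simp)
    rw [Finset.sum_insert ha, greedyPoint_apply, ← insert_filter_lt]
    linarith

theorem greedyPoint_mem (h0 : h ∅ = -h Finset.univ) (hs : IsSubmodular h)
    (σ : V ≃ Fin (Fintype.card V)) : greedyPoint σ h ∈ deformedPermutahedron h := by
  refine (mem_deformedPermutahedron_iff h0).2 ⟨?_, sum_greedyPoint_le hs⟩
  rw [sum_greedyPoint_of_isInitial fun _ _ _ _ => Finset.mem_univ _, h0]
  ring

theorem signedSum_greedyPoint (h0 : h ∅ = -h Finset.univ) {S : Finset V} (hS : IsInitial σ S) :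
    signedSum S (greedyPoint σ h) = h S := by
  rw [signedSum_eq, sum_greedyPoint_of_isInitial hS,
    sum_greedyPoint_of_isInitial fun _ _ _ _ => Finset.mem_univ _, h0]
  ring

/-- Abel summation: a weight that decreases along `σ` pairs non-negatively with a vector of total
`0` whose sums over initial segments are non-negative. -/
theorem sum_mul_nonneg_of_antitone {c d : V → ℝ} (hc : ∀ v w, σ v ≤ σ w → c w ≤ c v)
    (hd : ∀ S, IsInitial σ S → 0 ≤ ∑ v ∈ S, d v) (hd0 : ∑ v, d v = 0) :
    0 ≤ ∑ v, c v * d v := by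
  have key : ∀ S, IsInitial σ S → ∀ m, (∀ v ∈ S, m ≤ c v) →
      m * ∑ v ∈ S, d v ≤ ∑ v ∈ S, c v * d v := by
    intro S hS
    refine hS.induction (motive := fun S => ∀ m, (∀ v ∈ S, m ≤ c v) →
      m * ∑ v ∈ S, d v ≤ ∑ v ∈ S, c v * d v) (by simp) fun a ih m hm => ?_
    have h1 := ih (c a) fun v hv => hc v a (by simpa using (Finset.mem_filter.1 hv).2.le)
    have h2 : 0 ≤ ∑ v ∈ insert a (Finset.univ.filter fun w => σ w < σ a), d v := by
      refine hd _ fun v hv w hw => ?_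
      rw [insert_filter_lt] at hv ⊢
      simp only [Finset.mem_filter, Finset.mem_univ, true_and] at hv ⊢
      exact hw.trans hv
    have h3 := mul_le_mul_of_nonneg_right (hm a (Finset.mem_insert_self _ _)) h2
    refine h3.trans ?_
    rw [Finset.sum_insert (by simp), Finset.sum_insert (by simp)]
    linarith
  obtain ⟨m, hm⟩ := (Set.finite_range c).bddBelow
  have := key Finset.univ (fun _ _ _ _ => Finset.mem_univ _) m fun v _ => hm ⟨v, rfl⟩
  rwa [hd0, mul_zero] at this

/-- The greedy point of an order along which `c` decreases maximizes `c` over `P_h`. -/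
theorem sum_mul_le_greedyPoint (h0 : h ∅ = -h Finset.univ) (hs : IsSubmodular h) {c x : V → ℝ}
    (hc : ∀ v w, σ v ≤ σ w → c w ≤ c v) (hx : x ∈ deformedPermutahedron h) :
    ∑ v, c v * x v ≤ ∑ v, c v * greedyPoint σ h v := by
  rw [mem_deformedPermutahedron_iff h0] at hx
  have h1 := sum_mul_nonneg_of_antitone (d := greedyPoint σ h - x) hc
    (fun S hS => by
      simp only [Pi.sub_apply, Finset.sum_sub_distrib]
      linarith [hx.2 S, sum_greedyPoint_of_isInitial (h := h) hS])
    (by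
      simp only [Pi.sub_apply, Finset.sum_sub_distrib]
      linarith [hx.1, sum_eq_of_mem h0 (greedyPoint_mem h0 hs σ)])
  simp only [Pi.sub_apply, mul_sub, Finset.sum_sub_distrib] at h1
  linarith

theorem convex_deformedPermutahedron (h : Finset V → ℝ) :
    Convex ℝ (deformedPermutahedron h) := by
  intro x hx y hy a b ha hb hab S
  change signedSum S (a • x + b • y) ≤ h S
  rw [signedSum_add, signedSum_smul, signedSum_smul]
  have h1 := mul_le_mul_of_nonneg_left (show signedSum S x ≤ h S from hx S) ha
  have h2 := mul_le_mul_of_nonneg_left (show signedSum S y ≤ h S from hy S) hb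
  calc _ ≤ a * h S + b * h S := add_le_add h1 h2
    _ = h S := by rw [← add_mul, hab, one_mul]

theorem deformedPermutahedron_eq_convexHull (h0 : h ∅ = -h Finset.univ) (hs : IsSubmodular h) :
    deformedPermutahedron h = convexHull ℝ (Set.range fun σ => greedyPoint σ h) := by
  refine Set.Subset.antisymm (fun x hx => ?_) (convexHull_min ?_ (convex_deformedPermutahedron h))
  · by_contra hxQ
    obtain ⟨c, hc⟩ := exists_separating (convex_convexHull ℝ _)
      ((Set.finite_range fun σ => greedyPoint σ h).isClosed_convexHull ℝ) hxQ
    obtain ⟨σ, hσ⟩ := exists_order_antitone c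
    exact absurd (hc _ (subset_convexHull ℝ _ ⟨σ, rfl⟩))
      (sum_mul_le_greedyPoint h0 hs hσ hx).not_gt
  · rintro _ ⟨σ, rfl⟩
    exact greedyPoint_mem h0 hs σ

theorem isPolytope_deformedPermutahedron (h0 : h ∅ = -h Finset.univ) (hs : IsSubmodular h) :
    IsPolytope (deformedPermutahedron h) := by
  classical
  refine ⟨Finset.univ.image fun σ => greedyPoint σ h, ?_⟩
  rw [deformedPermutahedron_eq_convexHull h0 hs]
  simp

/-- The inequalities of two nested sets are simultaneously tight at some point of `P_h`. -/
theorem exists_tight (h0 : h ∅ = -h Finset.univ) (hs : IsSubmodular h) {S T : Finset V}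
    (hST : S ⊆ T) :
    ∃ x ∈ deformedPermutahedron h, signedSum S x = h S ∧ signedSum T x = h T := by
  -- an order that lists first `S`, then the rest of `T`, then the other vertices
  obtain ⟨σ, hσ⟩ := exists_order_antitone fun v =>
    (if v ∈ S then 1 else 0) + (if v ∈ T then (1 : ℝ) else 0)
  refine ⟨greedyPoint σ h, greedyPoint_mem h0 hs σ, signedSum_greedyPoint h0 ?_,
    signedSum_greedyPoint h0 ?_⟩
  · intro v hv w hw
    have := hσ w v hw
    by_contra hwS
    simp only [hv, hST hv, hwS, if_true, if_false] at this
    split_ifs at this <;> linarith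
  · intro v hv w hw
    have := hσ w v hw
    by_contra hwT
    have hwS : w ∉ S := fun h => hwT (hST h)
    simp only [hv, hwT, hwS, if_true, if_false] at this
    split_ifs at this <;> linarith

theorem deformedPermutahedron_add {h' : Finset V → ℝ} (h0 : h ∅ = -h Finset.univ)
    (hs : IsSubmodular h) (h0' : h' ∅ = -h' Finset.univ) (hs' : IsSubmodular h') :
    deformedPermutahedron (h + h') = deformedPermutahedron h + deformedPermutahedron h' := by
  refine Set.Subset.antisymm ?_ ?_
  · rw [deformedPermutahedron_eq_convexHull (h := h + h')]
    · refine convexHull_min ?_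
        ((convex_deformedPermutahedron h).add (convex_deformedPermutahedron h'))
      rintro _ ⟨σ, rfl⟩
      exact ⟨_, greedyPoint_mem h0 hs σ, _, greedyPoint_mem h0' hs' σ, (map_add _ _ _).symm⟩
    · simp only [Pi.add_apply, h0, h0']
      ring
    · intro X u v hu hv huv
      rw [map_add]
      exact add_nonneg (hs X u v hu hv huv) (hs' X u v hu hv huv)
  · rintro _ ⟨x, hx, y, hy, rfl⟩ S
    change signedSum S (x + y) ≤ h S + h' S
    rw [signedSum_add]
    exact add_le_add (hx S) (hy S)

theorem deformedPermutahedron_zero :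
    deformedPermutahedron (0 : Finset V → ℝ) = {0} := by
  ext x
  rw [mem_deformedPermutahedron_iff (by simp), Set.mem_singleton_iff]
  constructor
  · rintro ⟨h1, h2⟩
    have h3 : ∀ v ∈ Finset.univ, x v ≤ 0 := fun v _ => by simpa using h2 {v}
    funext v
    exact (Finset.sum_eq_zero_iff_of_nonpos h3).1 (by simpa using h1) v (Finset.mem_univ v)
  · rintro rfl
    simp

theorem deformedPermutahedron_smul (h0 : h ∅ = -h Finset.univ) (hs : IsSubmodular h) {r : ℝ}
    (hr : 0 ≤ r) : deformedPermutahedron (r • h) = r • deformedPermutahedron h := by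
  rcases hr.eq_or_lt with rfl | hr
  · obtain ⟨x, hx, -⟩ := exists_tight h0 hs (Finset.Subset.refl ∅)
    rw [zero_smul, deformedPermutahedron_zero, Set.zero_smul_set ⟨x, hx⟩, Set.singleton_zero]
  · ext x
    rw [Set.mem_smul_set_iff_inv_smul_mem₀ hr.ne']
    refine forall_congr' fun S => ?_
    change signedSum S x ≤ r * h S ↔ signedSum S (r⁻¹ • x) ≤ h S
    rw [signedSum_smul, inv_mul_le_iff₀ hr]

theorem deformedPermutahedron_injective {h' : Finset V → ℝ} (h0 : h ∅ = -h Finset.univ)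
    (hs : IsSubmodular h) (h0' : h' ∅ = -h' Finset.univ) (hs' : IsSubmodular h')
    (heq : deformedPermutahedron h = deformedPermutahedron h') : h = h' := by
  funext S
  obtain ⟨x, hx, hxS, -⟩ := exists_tight h0 hs (Finset.Subset.refl S)
  obtain ⟨y, hy, hyS, -⟩ := exists_tight h0' hs' (Finset.Subset.refl S)
  refine le_antisymm ?_ ?_
  · rw [← hxS]
    exact (heq ▸ hx : x ∈ deformedPermutahedron h') S
  · rw [← hyS]
    exact (heq ▸ hy : y ∈ deformedPermutahedron h) S

end Greedy

/-! ### The deformation cone of the graphical zonotope -/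

section Zonotope

variable {V : Type*} [Fintype V] [DecidableEq V] {G : SimpleGraph V} {h : Finset V → ℝ}

theorem edgeHeight_empty (e : Sym2 V) : edgeHeight e ∅ = -edgeHeight e Finset.univ := by
  induction e with
  | _ u v => simp [edgeHeight_mk]

theorem isSubmodular_edgeHeight (e : Sym2 V) : IsSubmodular (edgeHeight e) := by
  intro X u v hu hv huv
  rw [secondDiff_edgeHeight e hu hv huv]
  split_ifs <;> norm_num

theorem pairSegment_eq {e : Sym2 V} (he : ¬ e.IsDiag) :
    pairSegment e = deformedPermutahedron (edgeHeight e) := by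
  have h0 := edgeHeight_empty e
  induction e with
  | _ u v =>
  have huv : u ≠ v := by simpa using he
  change segment ℝ (Pi.single u (1 : ℝ)) (Pi.single v (1 : ℝ)) = _
  refine Set.Subset.antisymm ((convex_deformedPermutahedron _).segment_subset ?_ ?_) ?_
  · rw [mem_deformedPermutahedron_iff h0]
    refine ⟨by simp [edgeHeight_mk], fun S => ?_⟩
    by_cases h1 : u ∈ S <;> by_cases h2 : v ∈ S <;> simp [edgeHeight_mk, h1, h2]
  · rw [mem_deformedPermutahedron_iff h0]
    refine ⟨by simp [edgeHeight_mk], fun S => ?_⟩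
    by_cases h1 : u ∈ S <;> by_cases h2 : v ∈ S <;> simp [edgeHeight_mk, h1, h2]
  · intro x hx
    rw [mem_deformedPermutahedron_iff h0] at hx
    obtain ⟨h1, h2⟩ := hx
    replace h1 : ∑ v, x v = 1 := by simpa [edgeHeight_mk] using h1
    have hnonneg : ∀ w, 0 ≤ x w := by
      intro w
      have h3 := h2 (Finset.univ.erase w)
      have h4 := Finset.add_sum_erase Finset.univ x (Finset.mem_univ w)
      have h5 : (edgeHeight s(u, v) (Finset.univ.erase w) - edgeHeight s(u, v) ∅) / 2 ≤ 1 := by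
        simp only [edgeHeight_mk]
        split_ifs <;> norm_num
      linarith
    have hzero : ∀ w, w ≠ u → w ≠ v → x w = 0 := by
      intro w hwu hwv
      have h3 := h2 {w}
      rw [edgeHeight_mk, edgeHeight_mk, if_neg (by simp [hwu.symm, hwv.symm]),
        if_neg (by simp)] at h3
      simp only [Finset.sum_singleton, sub_self, zero_div] at h3
      exact le_antisymm h3 (hnonneg w)
    refine ⟨x u, x v, hnonneg u, hnonneg v, ?_, ?_⟩
    · rw [← h1, ← Finset.sum_subset (Finset.subset_univ {u, v}), Finset.sum_pair huv]
      intro w _ hw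
      simp only [Finset.mem_insert, Finset.mem_singleton, not_or] at hw
      exact hzero w hw.1 hw.2
    · funext w
      by_cases hwu : w = u
      · subst hwu
        simp [huv]
      by_cases hwv : w = v
      · subst hwv
        simp [hwu]
      simp [hwu, hwv, hzero w hwu hwv]

theorem sum_pairSegment_eq {s : Finset (Sym2 V)} (hs : ∀ e ∈ s, ¬ e.IsDiag) :
    ∑ e ∈ s, pairSegment e = deformedPermutahedron (∑ e ∈ s, edgeHeight e) := by
  suffices hsuff : (∑ e ∈ s, edgeHeight e) ∅ = -(∑ e ∈ s, edgeHeight e) Finset.univ ∧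
      IsSubmodular (∑ e ∈ s, edgeHeight e) ∧
      ∑ e ∈ s, pairSegment e = deformedPermutahedron (∑ e ∈ s, edgeHeight e) from hsuff.2.2
  induction s using Finset.induction_on with
  | empty =>
    simp only [Finset.sum_empty, deformedPermutahedron_zero, Set.singleton_zero, and_true]
    exact ⟨by simp, fun X u v _ _ _ => by simp⟩
  | insert e s he ih =>
    obtain ⟨ih0, ihs, ih⟩ := ih fun e' he' => hs e' (Finset.mem_insert_of_mem he')
    rw [Finset.sum_insert he, Finset.sum_insert he]
    refine ⟨?_, fun X u v hu hv huv => ?_, ?_⟩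
    · rw [Pi.add_apply, Pi.add_apply, ih0, edgeHeight_empty, neg_add]
    · rw [map_add]
      exact add_nonneg (isSubmodular_edgeHeight e X u v hu hv huv) (ihs X u v hu hv huv)
    · rw [deformedPermutahedron_add (edgeHeight_empty e) (isSubmodular_edgeHeight e) ih0 ihs, ih,
        pairSegment_eq (hs e (Finset.mem_insert_self _ _))]

theorem mem_heightCone_iff :
    h ∈ heightCone G ↔ h ∅ = -h Finset.univ ∧ IsModularOffEdges G h ∧ IsSubmodular h :=
  ⟨fun hh => ⟨hh.1.1, (mem_equationSpace_iff.1 hh.1).2, isSubmodular_of_mem_heightCone hh⟩,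
    fun hh => mem_heightCone_of_isSubmodular hh.1 hh.2.1 hh.2.2⟩

theorem exists_max_signedSum {Q : Set (V → ℝ)} (hQ : IsPolytope Q) (hne : Q.Nonempty) :
    ∃ h : Finset V → ℝ, ∀ S, (∃ x ∈ Q, signedSum S x = h S) ∧ ∀ x ∈ Q, signedSum S x ≤ h S := by
  obtain ⟨s, rfl⟩ := hQ
  have hcomp : IsCompact (convexHull ℝ (s : Set (V → ℝ))) :=
    s.finite_toSet.isCompact_convexHull ℝ
  have hmax : ∀ S : Finset V, ∃ x ∈ convexHull ℝ (s : Set (V → ℝ)),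
      ∀ y ∈ convexHull ℝ (s : Set (V → ℝ)), signedSum S y ≤ signedSum S x := by
    intro S
    have hcont : Continuous fun x : V → ℝ => signedSum S x := by
      unfold signedSum
      fun_prop
    exact hcomp.exists_isMaxOn hne hcont.continuousOn
  choose m hm hle using hmax
  exact ⟨fun S => signedSum S (m S), fun S => ⟨⟨m S, hm S, rfl⟩, hle S⟩⟩

/-- If `Q + R = P_k` with `k` in the height cone, then the maxima of the signed sums over `Q` form
an element of the height cone: a point `q + r` of `P_k` at which several inequalities are tight
decomposes into points of `Q` and `R` at which the same signed sums are maximal. For nested sets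
such a point exists by submodularity of `k`; where `k` is modular, it is also tight for the other
two sets of the equation. -/
theorem mem_heightCone_of_add_eq {k : Finset V → ℝ} (hk : k ∈ heightCone G) {Q R : Set (V → ℝ)}
    (hQR : Q + R = deformedPermutahedron k)
    (hmax : ∀ S, (∃ x ∈ Q, signedSum S x = h S) ∧ ∀ x ∈ Q, signedSum S x ≤ h S) :
    h ∈ heightCone G := by
  obtain ⟨k0, km, ks⟩ := mem_heightCone_iff.1 hk
  have htight : ∀ {q r : V → ℝ} {S : Finset V}, q ∈ Q → r ∈ R → signedSum S (q + r) = k S →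
      signedSum S q = h S := by
    intro q r S hq hr hS
    obtain ⟨⟨q', hq', hq'S⟩, hle⟩ := hmax S
    have h1 : signedSum S (q' + r) ≤ k S :=
      (hQR ▸ Set.add_mem_add hq' hr : q' + r ∈ deformedPermutahedron k) S
    rw [signedSum_add] at h1 hS
    linarith [hle q hq]
  have hpoint : ∀ S T : Finset V, S ⊆ T → ∃ q ∈ Q, ∃ r ∈ R,
      signedSum S (q + r) = k S ∧ signedSum T (q + r) = k T := by
    intro S T hST
    obtain ⟨x, hx, hxS, hxT⟩ := exists_tight k0 ks hST
    obtain ⟨q, hq, r, hr, rfl⟩ := Set.mem_add.1 (hQR.symm ▸ hx : x ∈ Q + R)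
    exact ⟨q, hq, r, hr, hxS, hxT⟩
  refine mem_heightCone_iff.2 ⟨?_, fun X u v hu hv huv hadj => ?_, fun X u v hu hv huv => ?_⟩
  · obtain ⟨q, hq, r, hr, h1, h2⟩ := hpoint ∅ Finset.univ (Finset.empty_subset _)
    rw [← htight hq hr h1, ← htight hq hr h2]
    simp [signedSum]
  · obtain ⟨q, hq, r, hr, h1, h2⟩ := hpoint X (insert u (insert v X))
      ((Finset.subset_insert _ _).trans (Finset.subset_insert _ _))
    have h3 := km X u v hu hv huv hadj
    have h4 := signedSum_modular hu hv huv (q + r)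
    have h5 : q + r ∈ deformedPermutahedron k := hQR ▸ Set.add_mem_add hq hr
    have h6 : signedSum (insert u X) (q + r) ≤ k (insert u X) := h5 _
    have h7 : signedSum (insert v X) (q + r) ≤ k (insert v X) := h5 _
    rw [secondDiff_apply] at h3 ⊢
    rw [← htight hq hr h1, ← htight hq hr h2,
      ← htight hq hr (S := insert u X) (by linarith),
      ← htight hq hr (S := insert v X) (by linarith)]
    linarith [signedSum_modular hu hv huv q]
  · obtain ⟨q, hq, r, hr, h1, h2⟩ := hpoint X (insert u (insert v X))
      ((Finset.subset_insert _ _).trans (Finset.subset_insert _ _))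
    rw [secondDiff_apply, ← htight hq hr h1, ← htight hq hr h2]
    linarith [signedSum_modular hu hv huv q, (hmax (insert u X)).2 q hq,
      (hmax (insert v X)).2 q hq]

/-- Cancellation: a closed convex summand `Q` cannot be smaller than the polytope `P_h` that
contains it, when the other summand lies in `P_g` and the total is `P_h + P_g`. -/
theorem eq_of_add_eq {g : Finset V → ℝ} (g0 : g ∅ = -g Finset.univ) (gs : IsSubmodular g)
    {Q R A : Set (V → ℝ)} (hconv : Convex ℝ Q) (hclosed : IsClosed Q) (hQ : Q ⊆ A)
    (hR : R ⊆ deformedPermutahedron g) (hsum : Q + R = A + deformedPermutahedron g) :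
    Q = A := by
  refine hQ.antisymm fun x hx => ?_
  by_contra hxQ
  obtain ⟨c, hc⟩ := exists_separating hconv hclosed hxQ
  obtain ⟨σ, hσ⟩ := exists_order_antitone c
  have h1 : x + greedyPoint σ g ∈ Q + R :=
    hsum ▸ Set.add_mem_add hx (greedyPoint_mem g0 gs σ)
  obtain ⟨q, hq, r, hr, hqr⟩ := Set.mem_add.1 h1
  have h2 := sum_mul_add c q r
  rw [hqr, sum_mul_add] at h2
  linarith [hc q hq, sum_mul_le_greedyPoint g0 gs hσ (hR hr)]

variable [DecidableRel G.Adj]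

theorem graphicalZonotope_eq :
    graphicalZonotope G = deformedPermutahedron (zonotopeHeight G) :=
  sum_pairSegment_eq fun _ he =>
    G.not_isDiag_of_mem_edgeSet (SimpleGraph.mem_edgeFinset.1 he)

theorem zonotopeHeight_mem_heightCone : zonotopeHeight G ∈ heightCone G := by
  rw [heightCone_eq]
  exact ⟨zonotopeHeight_mem, fun i => (ineqForm_zonotopeHeight_pos i).le⟩

/-- All second differences of the height vector of the zonotope at edges are positive, so that
some multiple of it exceeds `h` by an element of the height cone. -/
theorem deformedPermutahedron_mem_deformationCone (hh : h ∈ heightCone G) :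
    deformedPermutahedron h ∈ deformationCone (graphicalZonotope G) := by
  obtain ⟨h0, -, hs⟩ := mem_heightCone_iff.1 hh
  obtain ⟨z0, -, zs⟩ := mem_heightCone_iff.1 (zonotopeHeight_mem_heightCone (G := G))
  obtain ⟨t, ht, hpos⟩ := exists_nonneg_add_smul (ineqForm G) (-h) (zonotopeHeight G)
  have hR : -h + t • zonotopeHeight G ∈ heightCone G := by
    rw [heightCone_eq] at hh ⊢
    exact ⟨Submodule.add_mem _ (Submodule.neg_mem _ hh.1)
      (Submodule.smul_mem _ _ zonotopeHeight_mem),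
      fun i => hpos i (ineqForm_zonotopeHeight_pos i)⟩
  obtain ⟨r0, -, rs⟩ := mem_heightCone_iff.1 hR
  refine ⟨isPolytope_deformedPermutahedron h0 hs, t, ht, _,
    isPolytope_deformedPermutahedron r0 rs, ?_⟩
  rw [← deformedPermutahedron_add h0 hs r0 rs, graphicalZonotope_eq,
    ← deformedPermutahedron_smul z0 zs ht, add_neg_cancel_left]

theorem exists_of_mem_deformationCone {Q : Set (V → ℝ)}
    (hQ : Q ∈ deformationCone (graphicalZonotope G)) :
    ∃ h ∈ heightCone G, deformedPermutahedron h = Q := by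
  obtain ⟨hpoly, t, ht, R, hRpoly, hQR⟩ := hQ
  obtain ⟨z0, -, zs⟩ := mem_heightCone_iff.1 (zonotopeHeight_mem_heightCone (G := G))
  rw [graphicalZonotope_eq, ← deformedPermutahedron_smul z0 zs ht] at hQR
  have hk : t • zonotopeHeight G ∈ heightCone G := by
    rw [heightCone_eq]
    exact ⟨Submodule.smul_mem _ _ zonotopeHeight_mem, fun i => by
      rw [map_smul]
      exact mul_nonneg ht (ineqForm_zonotopeHeight_pos i).le⟩
  obtain ⟨k0, -, ks⟩ := mem_heightCone_iff.1 hk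
  have hne : (Q + R).Nonempty := by
    obtain ⟨x, hx, -⟩ := exists_tight k0 ks (Finset.Subset.refl ∅)
    exact ⟨x, hQR ▸ hx⟩
  obtain ⟨h, hmax⟩ := exists_max_signedSum hpoly hne.of_add_left
  obtain ⟨g, gmax⟩ := exists_max_signedSum hRpoly hne.of_add_right
  have hh := mem_heightCone_of_add_eq hk hQR hmax
  have hg := mem_heightCone_of_add_eq hk (by rwa [add_comm]) gmax
  obtain ⟨h0, -, hs⟩ := mem_heightCone_iff.1 hh
  obtain ⟨g0, -, gs⟩ := mem_heightCone_iff.1 hg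
  have hsum : h + g = t • zonotopeHeight G := by
    funext S
    obtain ⟨⟨q, hq, hqS⟩, hqmax⟩ := hmax S
    obtain ⟨⟨r, hr, hrS⟩, hrmax⟩ := gmax S
    refine le_antisymm ?_ ?_
    · rw [Pi.add_apply, ← hqS, ← hrS, ← signedSum_add]
      exact (hQR ▸ Set.add_mem_add hq hr :
        q + r ∈ deformedPermutahedron (t • zonotopeHeight G)) S
    · obtain ⟨x, hx, hxS, -⟩ := exists_tight k0 ks (Finset.Subset.refl S)
      obtain ⟨q', hq', r', hr', rfl⟩ := Set.mem_add.1 (hQR.symm ▸ hx : x ∈ Q + R)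
      rw [← hxS, signedSum_add]
      exact add_le_add (hqmax q' hq') (hrmax r' hr')
  refine ⟨h, hh, (eq_of_add_eq g0 gs (R := R) (A := deformedPermutahedron h) ?_ ?_
    (fun x hx S => (hmax S).2 x hx)
    (fun x hx S => (gmax S).2 x hx) ?_).symm⟩
  · obtain ⟨s, rfl⟩ := hpoly
    exact convex_convexHull ℝ _
  · obtain ⟨s, rfl⟩ := hpoly
    exact s.finite_toSet.isClosed_convexHull ℝ
  · rw [hQR, ← hsum, deformedPermutahedron_add h0 hs g0 gs]

/-! ### Facets of the height cone -/

theorem exists_only_tight_ineqForm (i : IneqIndex G) :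
    ∃ p ∈ equationSubmodule G, ineqForm G i p = 0 ∧
      ∀ j, ineqForm G j ≠ ineqForm G i → 0 < ineqForm G j p := by
  obtain ⟨p, hp, hp0, hpos⟩ := exists_only_tight i.2
  refine ⟨p, hp, hp0, fun j hj => hpos _ _ _ j.2 fun hkey => hj ?_⟩
  exact secondDiff_eq_of_key hkey.1 hkey.2

theorem key_eq_of_tightPart_eq {u v u' v' : V} {S S' : Finset V}
    (hS : IsIneqIndex G u v S) (hS' : IsIneqIndex G u' v' S')
    (heq : tightPart G u v S = tightPart G u' v' S') : s(u, v) = s(u', v') ∧ S = S' := by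
  by_contra hne
  obtain ⟨p, hp, hp0, hpos⟩ := exists_only_tight hS'
  have h1 : p ∈ tightPart G u' v' S' := by
    rw [tightPart_eq hS']
    refine ⟨⟨hp, fun j => ?_⟩, hp0⟩
    by_cases hj : s(j.1.1, j.1.2.1) = s(u', v') ∧ j.1.2.2 = S'
    · rw [ineqForm, secondDiff_eq_of_key hj.1 hj.2, hp0]
    · exact (hpos _ _ _ j.2 hj).le
  rw [← heq, tightPart_eq hS] at h1
  exact (hpos u v S hS hne).ne' h1.2

theorem ineqForm_ne_of_key_ne {i j : IneqIndex G}
    (hne : ¬ (s(j.1.1, j.1.2.1) = s(i.1.1, i.1.2.1) ∧ j.1.2.2 = i.1.2.2)) :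
    ineqForm G j ≠ ineqForm G i := by
  intro heq
  obtain ⟨p, -, hp0, hpos⟩ := exists_only_tight i.2
  have h1 := hpos _ _ _ j.2 hne
  change 0 < ineqForm G j p at h1
  rw [heq] at h1
  exact h1.ne' hp0

end Zonotope

end GraphicalZonotope

theorem mainTheorem1 {V : Type*} [Fintype V] [DecidableEq V] (G : SimpleGraph V)
    [DecidableRel G.Adj] :
    -- the deformation cone is the set of all `P_h` with `h` in the height cone
    deformationCone (graphicalZonotope G) = deformedPermutahedron '' heightCone G ∧
    -- `h ↦ P_h` identifies the two cones linearly
    Set.InjOn deformedPermutahedron (heightCone G) ∧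
    (∀ h ∈ heightCone G, ∀ h' ∈ heightCone G,
      deformedPermutahedron (h + h') = deformedPermutahedron h + deformedPermutahedron h') ∧
    (∀ h ∈ heightCone G, ∀ r : ℝ, 0 ≤ r →
      deformedPermutahedron (r • h) = r • deformedPermutahedron h) ∧
    -- the equations describe the linear span of the height cone
    (Submodule.span ℝ (heightCone G) : Set (Finset V → ℝ)) = equationSpace G ∧
    -- one modularity equation for each non-clique suffices, and these are linearly independent
    (∀ c : Finset V → V × V, IsNonEdgeChoice G c →
      {h | ∀ i, chosenForm G c i h = 0} = equationSpace G ∧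
      LinearIndependent ℝ (chosenForm G c)) ∧
    -- each inequality defines a facet
    (∀ (u v : V) (S : Finset V), IsIneqIndex G u v S →
      IsConeFacet (heightCone G) (tightPart G u v S)) ∧
    -- different inequalities define different facets
    (∀ (u v : V) (S : Finset V) (u' v' : V) (S' : Finset V),
      IsIneqIndex G u v S → IsIneqIndex G u' v' S' →
      tightPart G u v S = tightPart G u' v' S' → s(u, v) = s(u', v') ∧ S = S') ∧
    -- every facet is defined by one of the inequalities
    (∀ F : Set (Finset V → ℝ), IsConeFacet (heightCone G) F →
      ∃ (u v : V) (S : Finset V), IsIneqIndex G u v S ∧ F = tightPart G u v S) ∧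
    -- no inequality is implied by the equations and the other inequalities
    (∀ (u v : V) (S : Finset V), IsIneqIndex G u v S →
      ∃ h ∈ equationSpace G,
        h (S ∪ {u}) + h (S ∪ {v}) < h S + h (S ∪ {u, v}) ∧
        ∀ (a b : V) (X : Finset V), IsIneqIndex G a b X → ¬ (s(a, b) = s(u, v) ∧ X = S) →
          h X + h (X ∪ {a, b}) ≤ h (X ∪ {a}) + h (X ∪ {b})) := by
  refine ⟨?_, ?_, ?_, ?_, ?_,
    fun c hc => ⟨chosenForm_zeros c hc, linearIndependent_chosenForm c hc⟩, ?_,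
    fun u v S u' v' S' => key_eq_of_tightPart_eq, ?_, ?_⟩
  · ext Q
    constructor
    · exact exists_of_mem_deformationCone
    · rintro ⟨h, hh, rfl⟩
      exact deformedPermutahedron_mem_deformationCone hh
  · intro h hh h' hh' heq
    obtain ⟨h0, -, hs⟩ := mem_heightCone_iff.1 hh
    obtain ⟨h0', -, hs'⟩ := mem_heightCone_iff.1 hh'
    exact deformedPermutahedron_injective h0 hs h0' hs' heq
  · intro h hh h' hh'
    obtain ⟨h0, -, hs⟩ := mem_heightCone_iff.1 hh
    obtain ⟨h0', -, hs'⟩ := mem_heightCone_iff.1 hh'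
    exact deformedPermutahedron_add h0 hs h0' hs'
  · intro h hh r hr
    obtain ⟨h0, -, hs⟩ := mem_heightCone_iff.1 hh
    exact deformedPermutahedron_smul h0 hs hr
  · rw [heightCone_eq, span_ineqCone zonotopeHeight_mem ineqForm_zonotopeHeight_pos]
    rfl
  · intro u v S hS
    obtain ⟨p, hp, hp0, hpos⟩ := exists_only_tight_ineqForm (⟨(u, v, S), hS⟩ : IneqIndex G)
    rw [tightPart_eq hS, heightCone_eq]
    exact isConeFacet_tight zonotopeHeight_mem ineqForm_zonotopeHeight_pos hp hp0 hpos
  · intro F hF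
    rw [heightCone_eq] at hF
    obtain ⟨i, hi⟩ := exists_eq_tight_of_isConeFacet zonotopeHeight_mem
      ineqForm_zonotopeHeight_pos exists_only_tight_ineqForm hF
    exact ⟨_, _, _, i.2, by rw [hi, tightPart_eq i.2]⟩
  · intro u v S hS
    obtain ⟨p, hp, hp0, hpos⟩ := exists_only_tight_ineqForm (⟨(u, v, S), hS⟩ : IneqIndex G)
    obtain ⟨h, hh, hneg, hnonneg⟩ := exists_violating zonotopeHeight_mem
      ineqForm_zonotopeHeight_pos hp hp0 hpos
    refine ⟨h, hh, ?_, fun a b X hX hne => ?_⟩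
    · rw [ineqForm, secondDiff_apply'] at hneg
      linarith
    · have h1 := hnonneg ⟨(a, b, X), hX⟩ (ineqForm_ne_of_key_ne hne)
      rw [ineqForm, secondDiff_apply'] at h1
      linarith
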